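/- \textbf{Setting.} Let $1\le k\le d$, $d\ge 2$. For $A\in\mathbb R^{d\times d}$, sparse PCA is $\max\{x^\top A x:\ \|x\|_2=1,\ \|x\|_0\le k\}$, and its basic SDP relaxation is $\max\{\operatorname{tr}(AW):\ W\succeq 0,\ \operatorname{tr}W=1,\ \sum_{i,j}|W_{ij}|\le k\}$. \emph{Randomized rounding} with input $(A,W,k)$: put $p_i=\min\{1,\tfrac23 k\sqrt{W_{ii}}/\sum_j\sqrt{W_{jj}}+\tfrac1{12}kA_{ii}/\operatorname{tr}A\}$, select each $i\in\{1,\dots,d\}$ independently with probability $p_i$, and let $S$ be the set of selected indices; if $A\succeq0$ and $|S|<k$, enlarge $S$ by an arbitrary set of further indices to a set of cardinality $k$; return a maximizer of $y^\top A_{S,S}\,y$ over unit vectors $y$, extended by zero outside $S$ (the zero vector if $S=\emptyset$). \emph{Multi-run algorithm} with input $(A,W,k,N)$: let $S_0$ be a set of indices of $k$ largest diagonal entries of $W$, and let the greedy vector $z_0$ be a maximizer of $y^\top A_{S_0,S_0}\,y$ over unit vectors $y$, extended by zero; let $z_1,\dots,z_N$ be the outputs of $N$ independent runs of the randomized rounding;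 return a vector $z$ with largest $z^\top A z$ among those $z_0,\dots,z_N$ that are $k$-sparse unit vectors. All ties and free choices may be resolved arbitrarily. \emph{Model.} $A=(B+M)^\top(B+M)$, where $B\in\mathbb R^{n\times d}$ is a random matrix with i.i.d. rows of mean zero and covariance matrix $\Sigma$ that are sub-Gaussian with parameter $\sigma^2$ (that is, $\mathbb E\exp(t\langle u,B_r\rangle)\le\exp(\sigma^2t^2/2)$ for every row $B_r$, every unit vector $u$ and every $t\in\mathbb R$), and $M$ is a perturbation, which may depend on $B$ arbitrarily, all of whose columns have Euclidean norm at most $b$, where $b>0$ is a constant. Let $\lambda_1\ge\lambda_2$ be the two largest eigenvalues of $\Sigma$ (with multiplicity), assume $\lambda_1>\lambda_2$, assume that $\Sigma$ has a $k$-sparse unit eigenvector $v$ with eigenvalue $\lambda_1$, and put $a=\min_{i:v_i\ne0}|v_i|$. \textbf{Theorem.} There is an absolute constant $C^*>0$ such that the following holds for all such data. Put $$n^*=\max\Big\{C^*\Big[\frac{k^2\sigma^4\log d+b^2k^2(\sigma^2+\max_i\Sigma_{ii})}{(\lambda_1-\lambda_2)^2a^4}+\frac{kb^2}{(\lambda_1-\lambda_2)a^2}\Big],\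 \frac4{a^2},\ \log d\Big\}.$$ Let $l\ge1$ be real, suppose $n\ge l\,n^*$, let $W^*$ be an optimal solution of the SDP relaxation with input $(A,k)$, and put $r=1+\frac{2}{8\sqrt l-1}$. Then with probability at least $1-d^{-10}$ over the data the following hold, where $\mathrm{OPT}$ is the optimal value of sparse PCA with input $(A,k)$: the greedy vector $z_0$ is a $k$-sparse unit vector with $z_0^\top Az_0\ge \mathrm{OPT}/r$; and for every $N\ge0$, the multi-run algorithm with input $(A,W^*,k,N)$ has approximation ratio at most $r$, i.e. its output $z$ is a $k$-sparse unit vector with $\mathbb E[z^\top Az]\ge \mathrm{OPT}/r$, where the expectation is over the coins of the algorithm, and in fact $z^\top Az\ge \mathrm{OPT}/r$ for every outcome of the coins. -/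

import Mathlib

open MeasureTheory ProbabilityTheory Matrix
open scoped NNReal

noncomputable section

namespace SPCA

/-! ### Vectors, matrices, and the two optimization problems -/

/-- The Euclidean norm of a vector. -/
def l2norm {m : ℕ} (x : Fin m → ℝ) : ℝ := ‖WithLp.toLp 2 x‖

/-- The support of a vector. -/
def supp {d : ℕ} (x : Fin d → ℝ) : Finset (Fin d) := {i | x i ≠ 0}

/-- The quadratic form `xᵀ A x`. -/
def quadForm {d : ℕ} (A : Matrix (Fin d) (Fin d) ℝ) (x : Fin d → ℝ) : ℝ := x ⬝ᵥ (A *ᵥ x)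

/-- Feasibility for sparse PCA: `‖x‖₂ = 1` and `‖x‖₀ ≤ k`. -/
def IsFeasible {d : ℕ} (k : ℕ) (x : Fin d → ℝ) : Prop :=
  l2norm x = 1 ∧ (supp x).card ≤ k

/-- Feasibility for the basic SDP relaxation: `W ⪰ 0`, `tr W = 1`, `∑ |W i j| ≤ k`. -/
def IsSDPFeasible {d : ℕ} (k : ℕ) (W : Matrix (Fin d) (Fin d) ℝ) : Prop :=
  W.PosSemidef ∧ W.trace = 1 ∧ ∑ i, ∑ j, |W i j| ≤ k

/-- `W` is an optimal solution of the basic SDP relaxation `max tr(A W)`. -/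
def IsSDPOptimal {d : ℕ} (A : Matrix (Fin d) (Fin d) ℝ) (k : ℕ)
    (W : Matrix (Fin d) (Fin d) ℝ) : Prop :=
  IsSDPFeasible k W ∧ ∀ W', IsSDPFeasible k W' → (A * W').trace ≤ (A * W).trace

/-- The largest Euclidean norm of a column, i.e. the `1 → 2` operator norm. -/
def maxColNorm {n d : ℕ} (M : Matrix (Fin n) (Fin d) ℝ) : ℝ :=
  ⨆ j, l2norm (fun i => M i j)

/-- The `i`-th largest eigenvalue of a real symmetric matrix, with multiplicity, counting
from `i = 0`. -/
def sortedEigenvalue {d : ℕ} {S : Matrix (Fin d) (Fin d) ℝ} (hS : S.IsHermitian)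
    (i : Fin d) : ℝ :=
  hS.eigenvalues₀ (Fin.cast (Fintype.card_fin d).symm i)

/-- The smallest absolute value of a nonzero entry of `v` (used only for `v ≠ 0`). -/
def minAbsEntry {d : ℕ} (v : Fin d → ℝ) : ℝ := ⨅ i : {i // v i ≠ 0}, |v i|

/-! ### The algorithms -/

/-- `z`, extended by zero outside `S`, is a maximizer of `yᵀ A_{S,S} y` over unit vectors `y`
indexed by `S`. -/
def IsTopVectorOn {d : ℕ} (A : Matrix (Fin d) (Fin d) ℝ) (S : Finset (Fin d))
    (z : Fin d → ℝ) : Prop :=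
  supp z ⊆ S ∧ l2norm z = 1 ∧
    ∀ y, supp y ⊆ S → l2norm y = 1 → quadForm A y ≤ quadForm A z

/-- The inclusion probability
`p i = min {1, (2/3) k a i / ∑ j, a j + (1/12) k A i i / tr A}`, with `a i = √(W i i)`,
as an element of `[0,1]`. -/
def inclusionProb {d : ℕ} (A W : Matrix (Fin d) (Fin d) ℝ) (k : ℕ) (i : Fin d) :
    unitInterval :=
  Set.projIcc 0 1 zero_le_one
    (2 / 3 * (k * √(W i i) / ∑ j, √(W j j)) + 1 / 12 * (k * A i i / A.trace))

/-- The law of the coins of `N` independent runs of the randomized rounding: all coins are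
independent, and coin `i` of each run is `true` with probability `inclusionProb A W k i`. -/
def coinLaw {d : ℕ} (A W : Matrix (Fin d) (Fin d) ℝ) (k N : ℕ) :
    Measure (Fin N → Fin d → Bool) :=
  Measure.pi fun _ => Measure.pi fun i => bernoulliMeasure true false (inclusionProb A W k i)

/-- `z` is a possible output of one run of the randomized rounding whose coins came out as `c`:
`S` is the set of selected indices; if `A ⪰ 0` and `|S| < k`, it is enlarged by an
arbitrary set `T` to one of cardinality `k`; then `z` is a top unit vector on the resulting set
(and the zero vector if that set is empty). -/
def IsRoundingOutput {d : ℕ} (A : Matrix (Fin d) (Fin d) ℝ) (k : ℕ) (c : Fin d → Bool)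
    (z : Fin d → ℝ) : Prop :=
  ∃ S T : Finset (Fin d), (∀ i, i ∈ S ↔ c i = true) ∧ Disjoint S T ∧
    (A.PosSemidef ∧ S.card < k → T.card = k - S.card) ∧
    (¬ (A.PosSemidef ∧ S.card < k) → T = ∅) ∧
    ((S ∪ T).Nonempty → IsTopVectorOn A (S ∪ T) z) ∧
    (S ∪ T = ∅ → z = 0)

/-- `z` is a possible output of the greedy step: a top unit vector on a set of indices of
`k` largest diagonal entries of `W`. -/
def IsGreedyOutput {d : ℕ} (A W : Matrix (Fin d) (Fin d) ℝ) (k : ℕ)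
    (z : Fin d → ℝ) : Prop :=
  ∃ S₀ : Finset (Fin d), S₀.card = k ∧ (∀ i ∈ S₀, ∀ j ∉ S₀, W j j ≤ W i i) ∧
    IsTopVectorOn A S₀ z

/-- `z` is a possible output of the multi-run algorithm with input `(A, W, k, N)` whose coins
came out as `c`: a best `k`-sparse unit vector among the greedy vector and the outputs of the `N`
runs. All ties and free choices are resolved arbitrarily. -/
def IsMultiRunOutput {d : ℕ} (A W : Matrix (Fin d) (Fin d) ℝ) (k N : ℕ)
    (c : Fin N → Fin d → Bool) (z : Fin d → ℝ) : Prop :=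
  ∃ (z₀ : Fin d → ℝ) (y : Fin N → Fin d → ℝ),
    IsGreedyOutput A W k z₀ ∧ (∀ t, IsRoundingOutput A k (c t) (y t)) ∧
    (z = z₀ ∨ ∃ t, z = y t) ∧ IsFeasible k z ∧
    (IsFeasible k z₀ → quadForm A z₀ ≤ quadForm A z) ∧
    (∀ t, IsFeasible k (y t) → quadForm A (y t) ≤ quadForm A z)

/-- A fixed solution `z` is feasible and its value is at least `1 / r` times the optimum. -/
def IsApproxSolution {d : ℕ} (A : Matrix (Fin d) (Fin d) ℝ) (k : ℕ) (r : ℝ)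
    (z : Fin d → ℝ) : Prop :=
  IsFeasible k z ∧ ∀ x, IsFeasible k x → 1 / r * quadForm A x ≤ quadForm A z

/-- On input `(A, W, k, N)` the multi-run algorithm has approximation ratio (at most) `r`: however
ties and free choices are resolved, its output is feasible and its expected objective value, over
the coins of the algorithm, is at least `1 / r` times the optimum. -/
def HasApproxRatio {d : ℕ} (A W : Matrix (Fin d) (Fin d) ℝ) (k N : ℕ) (r : ℝ) : Prop :=
  ∀ z : (Fin N → Fin d → Bool) → Fin d → ℝ, (∀ c, IsMultiRunOutput A W k N c (z c)) →
    (∀ c, IsFeasible k (z c)) ∧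
    ∀ x, IsFeasible k x → 1 / r * quadForm A x ≤ ∫ c, quadForm A (z c) ∂(coinLaw A W k N)

/-! ### The statistical model -/

/-- The random matrix `B` has i.i.d. centered rows with covariance matrix `S`, sub-Gaussian with
parameter `σ²`: `𝔼 exp(t ⟨u, row⟩) ≤ exp(σ² t² / 2)` for all real `t` and unit vectors `u`. -/
structure IsSubGaussianSample {Ω : Type*} [MeasurableSpace Ω] (μ : Measure Ω) {n d : ℕ}
    (B : Ω → Matrix (Fin n) (Fin d) ℝ) (σ : ℝ≥0) (S : Matrix (Fin d) (Fin d) ℝ) : Prop where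
  measurable_row : ∀ r, Measurable fun ω => B ω r
  indep : iIndepFun (fun r ω => B ω r) μ
  identDistrib : ∀ r s, IdentDistrib (fun ω => B ω r) (fun ω => B ω s) μ μ
  mean_eq_zero : ∀ r i, ∫ ω, B ω r i ∂μ = 0
  covariance_eq : ∀ r i j, covariance (fun ω => B ω r i) (fun ω => B ω r j) μ = S i j
  subGaussian : ∀ r (u : Fin d → ℝ), l2norm u = 1 →
    HasSubgaussianMGF (fun ω => u ⬝ᵥ B ω r) (σ ^ 2) μ

/-- The sample bound
`max {C [(k² σ⁴ log d + b² k² (σ² + max Σ_ii)) / (gap² a⁴) + k b² / (gap a²)], 4 / a², log d}`,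
with `gap = λ₁ - λ₂` and `a` the smallest nonzero absolute entry of `v`. -/
def sampleBound (C : ℝ) {d : ℕ} (k : ℕ) (σ b gap : ℝ) (S : Matrix (Fin d) (Fin d) ℝ)
    (v : Fin d → ℝ) : ℝ :=
  max (C * ((k ^ 2 * σ ^ 4 * Real.log d + b ^ 2 * k ^ 2 * (σ ^ 2 + ⨆ i, S i i)) /
          (gap ^ 2 * minAbsEntry v ^ 4)
        + k * b ^ 2 / (gap * minAbsEntry v ^ 2)))
    (max (4 / minAbsEntry v ^ 2) (Real.log d))

end SPCA

end

/-!
The argument separates a high-probability event on the sample `B` from a deterministic statement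
valid for every perturbation `M`.

*Deterministic part.* Write `gap = λ₁ - λ₂`, let `a` be the smallest nonzero `|v i|`, and suppose
that `A / n` is entrywise within `ε` of the covariance matrix `S`, with
`k ε ≤ gap a² / (32 √l)`. Since `∑ |W i j| ≤ k` for every feasible `W`, the objective
`tr (A W) / n` differs from `tr (S W)` by at most `k ε` throughout the relaxation; this includes
the matrices `x xᵀ` with `x` feasible for sparse PCA. The bound
`S ⪯ λ₂ I + gap v vᵀ` (`quadForm_le_of_gap`) gives `tr (S W) ≤ λ₂ + gap vᵀ W v`, so comparing an
optimal `W` with `v vᵀ` yields `1 - vᵀ W v ≤ 2 k ε / gap ≤ a² / 16`. Off the support of `v` the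
diagonal of `W` is therefore at most `a² / 16` (`apply_self_le_trace_sub_quadForm`), while on the
support it is at least `a² / 4` (`abs_mul_sqrt_quadForm_le`). Hence the `k` largest diagonal
entries include the support of `v` (`supp_subset_of_largest_diag`), and the greedy value is at
least `vᵀ A v ≥ n (λ₁ - k ε)`, whereas the optimum is at most `n (λ₁ + k ε)`. As
`k ε ≤ λ₁ / (8 √l)`, the quotient is at most `(8 √l + 1) / (8 √l - 1)`
(`IsGreedyOutput.isApproxSolution`). The multi-run algorithm never does worse than its greedy
vector, whatever its coins.

*Probabilistic part.* The square of a sub-Gaussian variable is sub-exponential (`mgf_sq_le`), so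
Chernoff's bound applies to `∑ r, ⟨u, B r⟩²`. A union bound over the vectors `u = (eᵢ ± eⱼ) / 2`
and polarization show that all entries of `Bᵀ B / n` are within `288 σ² √(log d / n)` of those of
`S`, outside an event of probability at most `d⁻¹⁰`
(`IsSubGaussianSample.exists_good_event`). That event involves `B` only, so `M` may depend on `B`
in any way; the terms containing `M` are bounded by the Cauchy–Schwarz inequality
(`abs_perturbed_gram_sub_le`).
-/

namespace SPCA

/-! ### Squares of sub-Gaussian random variables -/

lemma exp_le_one_add_add_sq_mul_exp_abs (y : ℝ) :
    Real.exp y ≤ 1 + y + y ^ 2 * Real.exp |y| := by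
  have h1 : 1 ≤ Real.exp |y| := Real.one_le_exp (abs_nonneg y)
  rcases le_total |y| 1 with h | h
  · have := abs_le.1 (Real.abs_exp_sub_one_sub_id_le h)
    nlinarith [sq_nonneg y]
  · rcases le_abs'.1 h with h' | h'
    · have : Real.exp y ≤ 1 := Real.exp_le_one_iff.2 (by linarith)
      nlinarith [sq_nonneg y]
    · rw [abs_of_nonneg (by linarith)]
      have : 1 * Real.exp y ≤ y ^ 2 * Real.exp y :=
        mul_le_mul_of_nonneg_right (by nlinarith) (Real.exp_pos y).le
      linarith

lemma lintegral_exp_mul_gaussianReal (x : ℝ) :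
    ∫⁻ s, ENNReal.ofReal (Real.exp (x * s)) ∂(gaussianReal 0 (1 / 2)) =
      ENNReal.ofReal (Real.exp (x ^ 2 / 4)) := by
  rw [← ofReal_integral_eq_lintegral_ofReal (integrable_exp_mul_gaussianReal x)
    (ae_of_all _ fun _ => (Real.exp_pos _).le)]
  congr 1
  have := congrFun (mgf_fun_id_gaussianReal (μ := 0) (v := 1 / 2)) x
  rw [mgf] at this
  rw [this]
  congr 1
  push_cast
  ring

lemma lintegral_exp_sq_half_gaussianReal :
    ∫⁻ s, ENNReal.ofReal (Real.exp (s ^ 2 / 2)) ∂(gaussianReal 0 (1 / 2)) ≤ 2 := by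
  rw [gaussianReal_of_var_ne_zero _ (by norm_num),
    lintegral_withDensity_eq_lintegral_mul _ (measurable_gaussianPDF _ _) (by fun_prop)]
  calc _ = ∫⁻ s, ENNReal.ofReal (√2) * gaussianPDF 0 1 s := by
        refine lintegral_congr fun s => ?_
        simp only [Pi.mul_apply, gaussianPDF]
        rw [← ENNReal.ofReal_mul (gaussianPDFReal_nonneg _ _ _), ← ENNReal.ofReal_mul (by positivity)]
        congr 1
        simp only [gaussianPDFReal]
        rw [mul_assoc, ← Real.exp_add, ← mul_assoc]
        have h2 : √(2 * Real.pi * ((1 / 2 : ℝ≥0) : ℝ)) = √Real.pi := by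
          congr 1; push_cast; ring
        have h3 : √(2 * Real.pi * ((1 : ℝ≥0) : ℝ)) = √2 * √Real.pi := by
          rw [← Real.sqrt_mul (by norm_num)]; congr 1; push_cast; ring
        rw [h2, h3]
        congr 1
        · field_simp
        · congr 1; push_cast; ring
    _ = ENNReal.ofReal (√2) := by
        rw [lintegral_const_mul _ (measurable_gaussianPDF _ _),
          lintegral_gaussianPDF_eq_one _ one_ne_zero, mul_one]
    _ ≤ 2 := by
        rw [show (2 : ENNReal) = ENNReal.ofReal 2 by simp]
        refine ENNReal.ofReal_le_ofReal ?_
        rw [Real.sqrt_le_left (by norm_num)]; norm_num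

variable {Ω : Type*} [MeasurableSpace Ω] {μ : Measure Ω} [IsProbabilityMeasure μ]

/-- The square of a `1`-sub-Gaussian variable has an exponential moment. As
`exp (x² / 4) = 𝔼 exp (x g)` for a centred Gaussian `g` of variance `1 / 2`, this reduces by
Tonelli's theorem to a Gaussian integral. -/
lemma lintegral_exp_sq_le {X : Ω → ℝ} (hm : Measurable X) (h : HasSubgaussianMGF X 1 μ) :
    ∫⁻ ω, ENNReal.ofReal (Real.exp (X ω ^ 2 / 4)) ∂μ ≤ 2 := by
  simp_rw [← lintegral_exp_mul_gaussianReal]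
  rw [lintegral_lintegral_swap (by fun_prop)]
  refine le_trans (lintegral_mono fun s => ?_) lintegral_exp_sq_half_gaussianReal
  have hs : ∀ ω, X ω * s = s * X ω := fun ω => mul_comm _ _
  simp_rw [hs]
  rw [← ofReal_integral_eq_lintegral_ofReal (h.integrable_exp_mul s)
    (ae_of_all _ fun _ => (Real.exp_pos _).le)]
  refine ENNReal.ofReal_le_ofReal ?_
  simpa [mgf] using h.mgf_le s

lemma integrable_exp_sq {X : Ω → ℝ} (hm : Measurable X) (h : HasSubgaussianMGF X 1 μ) :
    Integrable (fun ω => Real.exp (X ω ^ 2 / 4)) μ := by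
  refine ⟨by fun_prop, ?_⟩
  rw [hasFiniteIntegral_iff_ofReal (ae_of_all _ fun _ => (Real.exp_pos _).le)]
  exact (lintegral_exp_sq_le hm h).trans_lt (by simp)

lemma integral_exp_sq_le {X : Ω → ℝ} (hm : Measurable X) (h : HasSubgaussianMGF X 1 μ) :
    ∫ ω, Real.exp (X ω ^ 2 / 4) ∂μ ≤ 2 := by
  rw [integral_eq_lintegral_of_nonneg_ae (ae_of_all _ fun _ => (Real.exp_pos _).le) (by fun_prop)]
  exact ENNReal.toReal_le_of_le_ofReal (by norm_num) (by simpa using lintegral_exp_sq_le hm h)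

lemma integrable_exp_mul_sq {X : Ω → ℝ} (hm : Measurable X) (h : HasSubgaussianMGF X 1 μ)
    {t : ℝ} (ht : |t| ≤ 1 / 8) : Integrable (fun ω => Real.exp (t * X ω ^ 2)) μ := by
  refine (integrable_exp_sq hm h).mono' (by fun_prop) (ae_of_all _ fun ω => ?_)
  rw [Real.norm_eq_abs, abs_of_pos (Real.exp_pos _)]
  refine Real.exp_le_exp.2 ?_
  nlinarith [sq_nonneg (X ω), (abs_le.1 ht).2]

/-- The square of a `1`-sub-Gaussian variable is sub-exponential. -/
lemma mgf_sq_le {X : Ω → ℝ} (hm : Measurable X) (h : HasSubgaussianMGF X 1 μ)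
    {t : ℝ} (ht : |t| ≤ 1 / 8) :
    mgf (fun ω => X ω ^ 2) μ t ≤ Real.exp (t * (∫ ω, X ω ^ 2 ∂μ) + 256 * t ^ 2) := by
  have hI : Integrable (fun ω => X ω ^ 2) μ := (h.memLp 2).integrable_sq
  have key : ∀ x : ℝ, Real.exp (t * x ^ 2) ≤
      1 + t * x ^ 2 + 128 * t ^ 2 * Real.exp (x ^ 2 / 4) := by
    intro x
    refine (exp_le_one_add_add_sq_mul_exp_abs _).trans ?_
    have e1 : Real.exp |t * x ^ 2| ≤ Real.exp (x ^ 2 / 8) := by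
      refine Real.exp_le_exp.2 ?_
      rw [abs_mul, abs_of_nonneg (sq_nonneg x)]
      nlinarith [sq_nonneg x]
    have e2 : (x ^ 2) ^ 2 ≤ 128 * Real.exp (x ^ 2 / 8) := by
      have := Real.quadratic_le_exp_of_nonneg (x := x ^ 2 / 8) (by positivity)
      nlinarith [sq_nonneg x]
    have e3 : Real.exp (x ^ 2 / 4) = Real.exp (x ^ 2 / 8) * Real.exp (x ^ 2 / 8) := by
      rw [← Real.exp_add]; congr 1; ring
    have e4 : (t * x ^ 2) ^ 2 * Real.exp |t * x ^ 2| ≤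
        t ^ 2 * (128 * Real.exp (x ^ 2 / 8) * Real.exp (x ^ 2 / 8)) := by
      rw [mul_pow, mul_assoc]
      gcongr
    rw [e3]; linarith
  have hE := integrable_exp_sq hm h
  have hE' := integral_exp_sq_le hm h
  calc mgf (fun ω => X ω ^ 2) μ t
      ≤ ∫ ω, (1 + t * X ω ^ 2 + 128 * t ^ 2 * Real.exp (X ω ^ 2 / 4)) ∂μ :=
        integral_mono (integrable_exp_mul_sq hm h ht)
          (((integrable_const 1).add (hI.const_mul t)).add (hE.const_mul _)) fun ω => key (X ω)
    _ = 1 + t * (∫ ω, X ω ^ 2 ∂μ) + 128 * t ^ 2 * ∫ ω, Real.exp (X ω ^ 2 / 4) ∂μ := by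
        have h1 : Integrable (fun ω => 1 + t * X ω ^ 2) μ :=
          (integrable_const 1).add (hI.const_mul t)
        rw [integral_add h1 (hE.const_mul _),
          integral_add (integrable_const 1) (hI.const_mul t), integral_const_mul,
          integral_const_mul]
        simp
    _ ≤ (t * (∫ ω, X ω ^ 2 ∂μ) + 256 * t ^ 2) + 1 := by nlinarith [sq_nonneg t]
    _ ≤ _ := Real.add_one_le_exp _

/-- Chernoff's bound for the empirical second moment of `1`-sub-Gaussian variables, with the
exponent `t = ± L / 8`. -/
lemma measureReal_abs_sum_sq_sub_gt_le {n : ℕ} {X : Fin n → Ω → ℝ} (hm : ∀ r, Measurable (X r))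
    (hi : iIndepFun X μ) (h : ∀ r, HasSubgaussianMGF (X r) 1 μ) {m : ℝ}
    (hmean : ∀ r, ∫ ω, X r ω ^ 2 ∂μ = m) {L : ℝ} (hL0 : 0 ≤ L) (hL1 : L ≤ 1) :
    μ.real {ω | 144 * n * L < |∑ r, X r ω ^ 2 - n * m|} ≤ 2 * Real.exp (-14 * n * L ^ 2) := by
  have hi2 : iIndepFun (fun r ω => X r ω ^ 2) μ :=
    hi.comp (fun _ x => x ^ 2) fun _ => by fun_prop
  have hmgf : ∀ t : ℝ, |t| ≤ 1 / 8 →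
      mgf (∑ r, fun ω => X r ω ^ 2) μ t ≤ Real.exp (n * (t * m + 256 * t ^ 2)) := by
    intro t ht
    rw [hi2.mgf_sum (fun r => (hm r).pow_const 2)]
    calc _ ≤ ∏ _r : Fin n, Real.exp (t * m + 256 * t ^ 2) :=
          Finset.prod_le_prod (fun _ _ => mgf_nonneg) fun r _ => by
            simpa [hmean r] using mgf_sq_le (hm r) (h r) ht
      _ = _ := by rw [Finset.prod_const, ← Real.exp_nat_mul]; simp
  have hint : ∀ t : ℝ, |t| ≤ 1 / 8 →
      Integrable (fun ω => Real.exp (t * (∑ r, fun ω => X r ω ^ 2) ω)) μ := fun t ht =>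
    hi2.integrable_exp_mul_sum (fun r => (hm r).pow_const 2)
      fun r _ => integrable_exp_mul_sq (hm r) (h r) ht
  have hn : (0 : ℝ) ≤ n := n.cast_nonneg
  have ht1 : |L / 8| ≤ 1 / 8 := by rw [abs_of_nonneg (by positivity)]; linarith
  have ht2 : |-(L / 8)| ≤ 1 / 8 := by rwa [abs_neg]
  have up : μ.real {ω | n * m + 144 * n * L ≤ (∑ r, fun ω => X r ω ^ 2) ω} ≤
      Real.exp (-14 * n * L ^ 2) := by
    refine (measure_ge_le_exp_mul_mgf _ (by positivity) (hint _ ht1)).trans ?_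
    refine (mul_le_mul_of_nonneg_left (hmgf _ ht1) (Real.exp_pos _).le).trans ?_
    rw [← Real.exp_add]
    exact Real.exp_le_exp.2 (by ring_nf; nlinarith [mul_nonneg hn (sq_nonneg L)])
  have low : μ.real {ω | (∑ r, fun ω => X r ω ^ 2) ω ≤ n * m - 144 * n * L} ≤
      Real.exp (-14 * n * L ^ 2) := by
    refine (measure_le_le_exp_mul_mgf _ (by linarith) (hint _ ht2)).trans ?_
    refine (mul_le_mul_of_nonneg_left (hmgf _ ht2) (Real.exp_pos _).le).trans ?_
    rw [← Real.exp_add]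
    exact Real.exp_le_exp.2 (by ring_nf; nlinarith [mul_nonneg hn (sq_nonneg L)])
  calc _ ≤ μ.real ({ω | n * m + 144 * n * L ≤ (∑ r, fun ω => X r ω ^ 2) ω} ∪
        {ω | (∑ r, fun ω => X r ω ^ 2) ω ≤ n * m - 144 * n * L}) := by
        refine measureReal_mono fun ω hω => ?_
        simp only [Set.mem_ofPred_eq, Set.mem_union, Finset.sum_apply] at hω ⊢
        rcases lt_abs.1 hω with h | h
        · left; linarith
        · right; linarith
    _ ≤ _ := (measureReal_union_le _ _).trans (by linarith)

end SPCA

namespace SPCA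

/-! ### Concentration of the sample covariance matrix -/

lemma l2norm_sq {m : ℕ} (x : Fin m → ℝ) : l2norm x ^ 2 = ∑ i, x i ^ 2 := by
  simp [l2norm, EuclideanSpace.norm_sq_eq]

lemma l2norm_nonneg {m : ℕ} (x : Fin m → ℝ) : 0 ≤ l2norm x := norm_nonneg _

lemma l2norm_smul {m : ℕ} (c : ℝ) (x : Fin m → ℝ) : l2norm (c • x) = |c| * l2norm x := by
  simp [l2norm, norm_smul]

lemma l2norm_add_le {m : ℕ} (x y : Fin m → ℝ) : l2norm (x + y) ≤ l2norm x + l2norm y := by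
  simpa [l2norm] using norm_add_le (WithLp.toLp 2 x) (WithLp.toLp 2 y)

lemma l2norm_single {m : ℕ} (i : Fin m) : l2norm (Pi.single i 1) = 1 := by
  have h : l2norm (Pi.single i 1 : Fin m → ℝ) ^ 2 = 1 := by
    rw [l2norm_sq]; simp [Pi.single_apply]
  nlinarith [l2norm_nonneg (Pi.single i 1 : Fin m → ℝ)]

variable {Ω : Type*} [MeasurableSpace Ω] {μ : Measure Ω} {n d : ℕ}
  {B : Ω → Matrix (Fin n) (Fin d) ℝ} {σ : ℝ≥0} {S : Matrix (Fin d) (Fin d) ℝ}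

lemma IsSubGaussianSample.measurable_dotProduct (hB : IsSubGaussianSample μ B σ S) (r : Fin n)
    (u : Fin d → ℝ) : Measurable fun ω => u ⬝ᵥ B ω r := by
  have := hB.measurable_row r
  simp only [dotProduct]
  refine Finset.measurable_sum _ fun i _ => ?_
  exact ((measurable_pi_apply i).comp this).const_mul _

lemma IsSubGaussianSample.memLp_apply (hB : IsSubGaussianSample μ B σ S) (r : Fin n)
    (i : Fin d) : MemLp (fun ω => B ω r i) 2 μ := by
  simpa using (hB.subGaussian r (Pi.single i 1) (l2norm_single i)).memLp 2

lemma hasSubgaussianMGF_const_mul_of_le {X : Ω → ℝ} {c c' : ℝ≥0} (h : HasSubgaussianMGF X c μ)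
    (a : ℝ) (hc : a ^ 2 * c ≤ c') : HasSubgaussianMGF (fun ω => a * X ω) c' μ := by
  refine ⟨(h.const_mul a).integrable_exp_mul, fun t => ?_⟩
  rw [mgf_const_mul]
  refine (h.mgf_le _).trans (Real.exp_le_exp.2 ?_)
  have := mul_le_mul_of_nonneg_right hc (sq_nonneg t)
  rw [mul_pow]
  linarith

variable [IsProbabilityMeasure μ]

lemma IsSubGaussianSample.subGaussian_of_le_one (hB : IsSubGaussianSample μ B σ S) (r : Fin n)
    {u : Fin d → ℝ} (hu : l2norm u ≤ 1) : HasSubgaussianMGF (fun ω => u ⬝ᵥ B ω r) (σ ^ 2) μ := by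
  rcases (l2norm_nonneg u).eq_or_lt with h0 | h0
  · have hu0 : u = 0 := by
      have := norm_eq_zero.1 h0.symm
      simpa using this
    subst hu0
    refine ⟨fun t => by simp, fun t => ?_⟩
    simp only [zero_dotProduct, mgf_const, mul_zero, Real.exp_zero]
    exact Real.one_le_exp (by positivity)
  · have h1 : l2norm ((l2norm u)⁻¹ • u) = 1 := by
      rw [l2norm_smul, abs_of_pos (inv_pos.2 h0), inv_mul_cancel₀ h0.ne']
    have h2 : HasSubgaussianMGF (fun ω => l2norm u * (((l2norm u)⁻¹ • u) ⬝ᵥ B ω r)) (σ ^ 2) μ :=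
      hasSubgaussianMGF_const_mul_of_le (hB.subGaussian r _ h1) _ <|
        mul_le_of_le_one_left (by positivity) (by nlinarith)
    simpa only [smul_dotProduct, smul_eq_mul, mul_inv_cancel_left₀ h0.ne'] using h2

lemma IsSubGaussianSample.integral_mul (hB : IsSubGaussianSample μ B σ S) (r : Fin n)
    (i j : Fin d) : ∫ ω, B ω r i * B ω r j ∂μ = S i j := by
  have := covariance_eq_sub (hB.memLp_apply r i) (hB.memLp_apply r j)
  rw [hB.covariance_eq, hB.mean_eq_zero, zero_mul, sub_zero] at this
  rw [this]; rfl

lemma IsSubGaussianSample.symm_apply (hB : IsSubGaussianSample μ B σ S) (r : Fin n)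
    (i j : Fin d) : S i j = S j i := by
  rw [← hB.integral_mul r, ← hB.integral_mul r]
  simp_rw [mul_comm]

lemma quadForm_eq_sum (A : Matrix (Fin d) (Fin d) ℝ) (x : Fin d → ℝ) :
    quadForm A x = ∑ i, ∑ j, x i * x j * A i j := by
  simp only [quadForm, dotProduct, mulVec, Finset.mul_sum]
  exact Finset.sum_congr rfl fun i _ => Finset.sum_congr rfl fun j _ => by ring

lemma IsSubGaussianSample.integral_dotProduct_sq (hB : IsSubGaussianSample μ B σ S) (r : Fin n)
    (u : Fin d → ℝ) : ∫ ω, (u ⬝ᵥ B ω r) ^ 2 ∂μ = quadForm S u := by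
  have hI : ∀ i j, Integrable (fun ω => u i * u j * (B ω r i * B ω r j)) μ := fun i j =>
    ((hB.memLp_apply r i).integrable_mul (hB.memLp_apply r j)).const_mul _
  have : ∀ ω, (u ⬝ᵥ B ω r) ^ 2 = ∑ i, ∑ j, u i * u j * (B ω r i * B ω r j) := by
    intro ω
    rw [sq, dotProduct, Finset.sum_mul_sum]
    exact Finset.sum_congr rfl fun i _ => Finset.sum_congr rfl fun j _ => by ring
  simp_rw [this]
  rw [integral_finsetSum _ fun i _ => integrable_finsetSum _ fun j _ => hI i j, quadForm_eq_sum]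
  refine Finset.sum_congr rfl fun i _ => ?_
  rw [integral_finsetSum _ fun j _ => hI i j]
  refine Finset.sum_congr rfl fun j _ => ?_
  rw [integral_const_mul, hB.integral_mul]

lemma IsSubGaussianSample.quadForm_nonneg (hB : IsSubGaussianSample μ B σ S) (r : Fin n)
    (u : Fin d → ℝ) : 0 ≤ quadForm S u := by
  rw [← hB.integral_dotProduct_sq r]
  exact integral_nonneg fun _ => sq_nonneg _

lemma IsSubGaussianSample.sigma_pos (hB : IsSubGaussianSample μ B σ S) (r : Fin n)
    {u : Fin d → ℝ} (hu : l2norm u = 1) (hS : quadForm S u ≠ 0) : 0 < σ := by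
  rcases eq_or_ne σ 0 with rfl | h
  · refine absurd ?_ hS
    have h := hB.subGaussian r u hu
    rw [zero_pow two_ne_zero] at h
    rw [← hB.integral_dotProduct_sq r]
    refine integral_eq_zero_of_ae ?_
    filter_upwards [h.ae_eq_zero_of_hasSubgaussianMGF_zero] with ω hω
    simp [hω]
  · exact pos_iff_ne_zero.2 h

lemma IsSubGaussianSample.measureReal_abs_sum_dotProduct_sq_sub_gt_le
    (hB : IsSubGaussianSample μ B σ S) (hσ : 0 < σ) (hd : 1 ≤ d) (hn : 0 < n)
    (hdn : Real.log d ≤ n) {u : Fin d → ℝ} (hu : l2norm u ≤ 1) :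
    μ.real {ω | 144 * σ ^ 2 * √(n * Real.log d) <
      |∑ r, (u ⬝ᵥ B ω r) ^ 2 - n * quadForm S u|} ≤ 2 * (d : ℝ) ^ (-14 : ℤ) := by
  have hn' : (0 : ℝ) < n := by exact_mod_cast hn
  have hd' : (1 : ℝ) ≤ d := by exact_mod_cast hd
  have hlog : 0 ≤ Real.log d := Real.log_nonneg hd'
  have hσ' : (0 : ℝ) < σ := hσ
  have hsub : ∀ r, HasSubgaussianMGF (fun ω => (σ : ℝ)⁻¹ * (u ⬝ᵥ B ω r)) 1 μ := by
    intro r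
    refine hasSubgaussianMGF_const_mul_of_le (hB.subGaussian_of_le_one r hu) _ (le_of_eq ?_)
    push_cast
    field_simp
  have key := measureReal_abs_sum_sq_sub_gt_le (μ := μ)
    (X := fun r ω => (σ : ℝ)⁻¹ * (u ⬝ᵥ B ω r))
    (fun r => (hB.measurable_dotProduct r u).const_mul _)
    (hB.indep.comp (fun _ x => (σ : ℝ)⁻¹ * (u ⬝ᵥ x)) fun _ => by
      simp only [dotProduct]; fun_prop)
    hsub (m := (σ : ℝ)⁻¹ ^ 2 * quadForm S u) (fun r => by
      simp_rw [mul_pow]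
      rw [integral_const_mul, hB.integral_dotProduct_sq])
    (L := √(Real.log d / n)) (Real.sqrt_nonneg _)
    (Real.sqrt_le_one.2 ((div_le_one hn').2 hdn))
  have e1 : 2 * Real.exp (-14 * n * √(Real.log d / n) ^ 2) = 2 * (d : ℝ) ^ (-14 : ℤ) := by
    rw [Real.sq_sqrt (by positivity), ← Real.rpow_intCast, Real.rpow_def_of_pos (by linarith)]
    congr 2
    push_cast
    field_simp
  rw [e1] at key
  refine le_trans (le_of_eq ?_) key
  congr 1
  ext ω
  simp only [Set.mem_ofPred_eq]
  have e2 : √(n * Real.log d) = n * √(Real.log d / n) := by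
    rw [show (n : ℝ) * Real.log d = n ^ 2 * (Real.log d / n) by field_simp,
      Real.sqrt_mul (by positivity), Real.sqrt_sq hn'.le]
  have e3 : ∑ r, ((σ : ℝ)⁻¹ * (u ⬝ᵥ B ω r)) ^ 2 - n * ((σ : ℝ)⁻¹ ^ 2 * quadForm S u) =
      (σ : ℝ)⁻¹ ^ 2 * (∑ r, (u ⬝ᵥ B ω r) ^ 2 - n * quadForm S u) := by
    simp_rw [mul_pow]
    rw [← Finset.mul_sum]; ring
  rw [e2, e3, abs_mul, abs_of_pos (by positivity : 0 < (σ : ℝ)⁻¹ ^ 2), inv_pow,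
    lt_inv_mul_iff₀ (by positivity)]
  ring_nf

/-- The vectors `(eᵢ ± eⱼ) / 2`, whose quadratic forms recover all entries of a symmetric matrix
by polarization. -/
noncomputable def polarVec (i j : Fin d) (s : Bool) : Fin d → ℝ :=
  (1 / 2 : ℝ) • (Pi.single i 1 + (if s then 1 else -1 : ℝ) • Pi.single j 1)

lemma l2norm_polarVec_le_one (i j : Fin d) (s : Bool) : l2norm (polarVec i j s) ≤ 1 := by
  rw [polarVec, l2norm_smul]
  have h := l2norm_add_le (Pi.single i 1 : Fin d → ℝ) ((if s then 1 else -1 : ℝ) • Pi.single j 1)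
  rw [l2norm_smul, l2norm_single, l2norm_single] at h
  have : |(if s then 1 else -1 : ℝ)| = 1 := by cases s <;> simp
  rw [this] at h
  rw [abs_of_pos (by norm_num)]
  linarith

lemma polarVec_dotProduct (i j : Fin d) (s : Bool) (x : Fin d → ℝ) :
    polarVec i j s ⬝ᵥ x = 1 / 2 * (x i + (if s then 1 else -1) * x j) := by
  cases s <;> simp [polarVec] <;> ring

lemma quadForm_polarVec (i j : Fin d) (s : Bool) :
    quadForm S (polarVec i j s) = 1 / 4 * (S i i + (if s then 1 else -1) * S i j +
      (if s then 1 else -1) * S j i + S j j) := by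
  rw [quadForm, polarVec_dotProduct]
  simp only [polarVec, mulVec_smul, mulVec_add, mulVec_single_one, Pi.smul_apply, Pi.add_apply,
    smul_eq_mul, col_apply]
  cases s <;> simp <;> ring

/-- With probability at least `1 - d⁻¹⁰` all entries of the sample covariance matrix are close to
those of `S`. The event depends on the sample alone. -/
lemma IsSubGaussianSample.exists_good_event (hB : IsSubGaussianSample μ B σ S) (hσ : 0 < σ)
    (hd : 2 ≤ d) (hn : 0 < n) (hdn : Real.log d ≤ n) :
    ∃ G : Set Ω, MeasurableSet G ∧ 1 - (d : ℝ) ^ (-10 : ℤ) ≤ μ.real G ∧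
      ∀ ω ∈ G, ∀ i j, |((B ω)ᵀ * B ω) i j - n * S i j| ≤ 288 * σ ^ 2 * √(n * Real.log d) := by
  set bad : Fin d × Fin d × Bool → Set Ω := fun p => {ω | 144 * σ ^ 2 * √(n * Real.log d) <
      |∑ r, (polarVec p.1 p.2.1 p.2.2 ⬝ᵥ B ω r) ^ 2 -
        n * quadForm S (polarVec p.1 p.2.1 p.2.2)|} with hbad
  have hmeas : ∀ p, MeasurableSet (bad p) := fun p => by
    refine measurableSet_lt measurable_const (Measurable.abs (Measurable.sub_const ?_ _))
    exact Finset.measurable_sum _ fun r _ => (hB.measurable_dotProduct r _).pow_const 2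
  have hU : MeasurableSet (⋃ p, bad p) := MeasurableSet.iUnion hmeas
  refine ⟨(⋃ p, bad p)ᶜ, hU.compl, ?_, fun ω hω i j => ?_⟩
  · rw [probReal_compl_eq_one_sub hU]
    have hd' : (2 : ℝ) ≤ d := by exact_mod_cast hd
    have h1 : μ.real (⋃ p, bad p) ≤ ∑ _p : Fin d × Fin d × Bool, 2 * (d : ℝ) ^ (-14 : ℤ) :=
      (measureReal_iUnion_fintype_le _).trans (Finset.sum_le_sum fun p _ =>
        hB.measureReal_abs_sum_dotProduct_sq_sub_gt_le hσ (by omega) hn hdn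
          (l2norm_polarVec_le_one _ _ _))
    have h2 : ∑ _p : Fin d × Fin d × Bool, 2 * (d : ℝ) ^ (-14 : ℤ) ≤ (d : ℝ) ^ (-10 : ℤ) := by
      have e : (d : ℝ) ^ (-10 : ℤ) = d ^ 4 * (d : ℝ) ^ (-14 : ℤ) := by
        rw [← zpow_natCast, ← zpow_add₀ (by positivity)]; norm_num
      simp only [Finset.sum_const, Finset.card_univ, Fintype.card_prod, Fintype.card_fin,
        Fintype.card_bool, nsmul_eq_mul]
      rw [e]
      push_cast
      have h4 : (d : ℝ) ^ 2 * 4 ≤ d ^ 4 := by nlinarith [mul_le_mul hd' hd' (by norm_num) (by linarith), sq_nonneg (d : ℝ)]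
      have := mul_le_mul_of_nonneg_right h4 (by positivity : 0 ≤ (d : ℝ) ^ (-14 : ℤ))
      linarith
    linarith
  · have hgood : ∀ s, |∑ r, (polarVec i j s ⬝ᵥ B ω r) ^ 2 - n * quadForm S (polarVec i j s)| ≤
        144 * σ ^ 2 * √(n * Real.log d) := by
      intro s
      by_contra hcon
      exact hω (Set.mem_iUnion.2 ⟨(i, j, s), not_le.1 hcon⟩)
    have h1 := hgood true
    have h2 := hgood false
    rw [quadForm_polarVec, hB.symm_apply ⟨0, hn⟩ j i] at h1 h2
    have e : ((B ω)ᵀ * B ω) i j - n * S i j =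
        (∑ r, (polarVec i j true ⬝ᵥ B ω r) ^ 2 - n * (1 / 4 * (S i i +
          (if true then 1 else -1) * S i j + (if true then 1 else -1) * S i j + S j j))) -
        (∑ r, (polarVec i j false ⬝ᵥ B ω r) ^ 2 - n * (1 / 4 * (S i i +
          (if false then 1 else -1) * S i j + (if false then 1 else -1) * S i j + S j j))) := by
      have : ((B ω)ᵀ * B ω) i j = ∑ r, (polarVec i j true ⬝ᵥ B ω r) ^ 2 -
          ∑ r, (polarVec i j false ⬝ᵥ B ω r) ^ 2 := by
        rw [← Finset.sum_sub_distrib, mul_apply]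
        refine Finset.sum_congr rfl fun r _ => ?_
        rw [polarVec_dotProduct, polarVec_dotProduct, transpose_apply]
        simp; ring
      rw [this]; simp; ring
    rw [e]
    refine (abs_sub _ _).trans ?_
    linarith

end SPCA

namespace SPCA

/-! ### Spectral bounds -/

variable {d : ℕ}

/-- A symmetric matrix whose largest eigenvalue is simple is dominated by `λ₂ I + (λ₁ - λ₂) v vᵀ`,
where `v` is the top unit eigenvector. -/
lemma quadForm_le_of_gap {S : Matrix (Fin d) (Fin d) ℝ} (hS : S.IsHermitian) (hd : 2 ≤ d)
    {v : Fin d → ℝ} (hv1 : l2norm v = 1)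
    (hv : S *ᵥ v = sortedEigenvalue hS ⟨0, by omega⟩ • v)
    (hgap : sortedEigenvalue hS ⟨1, by omega⟩ < sortedEigenvalue hS ⟨0, by omega⟩)
    (x : Fin d → ℝ) :
    quadForm S x ≤ sortedEigenvalue hS ⟨1, by omega⟩ * ∑ i, x i ^ 2 +
      (sortedEigenvalue hS ⟨0, by omega⟩ - sortedEigenvalue hS ⟨1, by omega⟩) * (v ⬝ᵥ x) ^ 2 := by
  set lam₁ := sortedEigenvalue hS ⟨0, by omega⟩
  set lam₂ := sortedEigenvalue hS ⟨1, by omega⟩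
  set u : Fin d → Fin d → ℝ := fun i => ⇑(hS.eigenvectorBasis i) with hu
  have parseval : ∀ x y : Fin d → ℝ, x ⬝ᵥ y = ∑ i, (u i ⬝ᵥ x) * (u i ⬝ᵥ y) := by
    intro x y
    have := hS.eigenvectorBasis.sum_inner_mul_inner (WithLp.toLp 2 x) (WithLp.toLp 2 y)
    simp only [EuclideanSpace.inner_eq_star_dotProduct, star_trivial] at this
    rw [dotProduct_comm, ← this]
    refine Finset.sum_congr rfl fun i _ => ?_
    rw [dotProduct_comm y]
  have hself : ∀ (w : Fin d → ℝ) i, u i ⬝ᵥ (S *ᵥ w) = hS.eigenvalues i * (u i ⬝ᵥ w) := by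
    intro w i
    have hT : Sᵀ = S := by simpa [conjTranspose_eq_transpose_of_trivial] using hS.eq
    rw [dotProduct_mulVec, ← mulVec_transpose, hT, hu, hS.mulVec_eigenvectorBasis,
      smul_dotProduct, smul_eq_mul]
  set e := Fintype.equivOfCardEq (α := Fin (Fintype.card (Fin d))) (β := Fin d) (Fintype.card_fin _)
  -- `i₀` is the index of the largest eigenvalue; all others are at most the second largest
  set i₀ : Fin d := e (Fin.cast (Fintype.card_fin d).symm ⟨0, by omega⟩)
  have h0 : hS.eigenvalues i₀ = lam₁ := by
    simp [IsHermitian.eigenvalues, i₀, e, lam₁, sortedEigenvalue]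
  have h1 : ∀ i ≠ i₀, hS.eigenvalues i ≤ lam₂ := by
    intro i hi
    refine hS.eigenvalues₀_antitone ?_
    have hne : e.symm i ≠ Fin.cast (Fintype.card_fin d).symm ⟨0, by omega⟩ := by
      intro h
      exact hi (by rw [← e.apply_symm_apply i, h])
    rw [Fin.le_def]
    have h2 : (e.symm i).val ≠ 0 := fun h => hne (Fin.ext (by simpa using h))
    change 1 ≤ (e.symm i).val
    omega
  have hvi : ∀ i ≠ i₀, u i ⬝ᵥ v = 0 := by
    intro i hi
    have h2 := hself v i
    rw [hv, dotProduct_smul, smul_eq_mul] at h2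
    have h3 : (lam₁ - hS.eigenvalues i) * (u i ⬝ᵥ v) = 0 := by linarith
    rcases mul_eq_zero.1 h3 with h | h
    · have := h1 i hi; linarith
    · exact h
  have hvx : ∀ y, v ⬝ᵥ y = (u i₀ ⬝ᵥ v) * (u i₀ ⬝ᵥ y) := by
    intro y
    rw [parseval]
    exact Finset.sum_eq_single _ (fun i _ hi => by rw [hvi i hi, zero_mul]) (by simp)
  have hv0 : (u i₀ ⬝ᵥ v) ^ 2 = 1 := by
    rw [sq, ← hvx, dotProduct]
    have := l2norm_sq v
    rw [hv1] at this
    simp_rw [← sq]; linarith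
  have hx2 : ∑ i, x i ^ 2 = ∑ i, (u i ⬝ᵥ x) ^ 2 := by
    have := parseval x x
    simp_rw [dotProduct, ← sq] at this
    simpa [dotProduct] using this
  rw [hvx, mul_pow, hv0, one_mul, hx2, quadForm, parseval]
  simp_rw [hself]
  rw [← Finset.add_sum_erase _ _ (Finset.mem_univ i₀),
    ← Finset.add_sum_erase _ (fun i => (u i ⬝ᵥ x) ^ 2) (Finset.mem_univ i₀), h0]
  have h4 : ∑ i ∈ Finset.univ.erase i₀, (u i ⬝ᵥ x) * (hS.eigenvalues i * (u i ⬝ᵥ x)) ≤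
      lam₂ * ∑ i ∈ Finset.univ.erase i₀, (u i ⬝ᵥ x) ^ 2 := by
    rw [Finset.mul_sum]
    refine Finset.sum_le_sum fun i hi => ?_
    nlinarith [h1 i (Finset.ne_of_mem_erase hi), sq_nonneg (u i ⬝ᵥ x)]
  linarith

lemma sortedEigenvalue_nonneg {S : Matrix (Fin d) (Fin d) ℝ} (hS : S.IsHermitian)
    (h : ∀ x, 0 ≤ quadForm S x) (i : Fin d) : 0 ≤ sortedEigenvalue hS i := by
  have hP : S.PosSemidef := .of_dotProduct_mulVec_nonneg hS fun x => by simpa [quadForm] using h x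
  have := hP.eigenvalues_nonneg (Fintype.equivOfCardEq (Fintype.card_fin _)
    (Fin.cast (Fintype.card_fin d).symm i))
  simpa [IsHermitian.eigenvalues, sortedEigenvalue] using this

/-! ### Positive semidefinite matrices of trace one -/

open scoped MatrixOrder Matrix.Norms.L2Operator in
lemma exists_eq_transpose_mul_self {W : Matrix (Fin d) (Fin d) ℝ} (hW : W.PosSemidef) :
    ∃ C : Matrix (Fin d) (Fin d) ℝ, W = Cᵀ * C := by
  obtain ⟨C, hC⟩ := CStarAlgebra.nonneg_iff_eq_star_mul_self.1 hW.nonneg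
  exact ⟨C, by rw [hC, star_eq_conjTranspose, conjTranspose_eq_transpose_of_trivial]⟩

lemma trace_mul_transpose_mul_self (A C : Matrix (Fin d) (Fin d) ℝ) :
    (A * (Cᵀ * C)).trace = ∑ r, quadForm A (C r) := by
  rw [← Matrix.mul_assoc, trace_mul_comm, ← Matrix.mul_assoc, trace]
  refine Finset.sum_congr rfl fun r _ => ?_
  rw [diag_apply, Matrix.mul_assoc, mul_apply, quadForm, dotProduct]
  rfl

lemma trace_transpose_mul_self (C : Matrix (Fin d) (Fin d) ℝ) :
    (Cᵀ * C).trace = ∑ r, ∑ i, C r i ^ 2 := by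
  rw [trace, Finset.sum_comm]
  simp [mul_apply, sq]

lemma quadForm_transpose_mul_self (C : Matrix (Fin d) (Fin d) ℝ) (x : Fin d → ℝ) :
    quadForm (Cᵀ * C) x = ∑ r, (x ⬝ᵥ C r) ^ 2 := by
  rw [quadForm, ← mulVec_mulVec, dotProduct_mulVec, vecMul_transpose, dotProduct]
  refine Finset.sum_congr rfl fun r _ => ?_
  rw [← sq, mulVec, dotProduct_comm]

lemma transpose_mul_self_apply_self (C : Matrix (Fin d) (Fin d) ℝ) (i : Fin d) :
    (Cᵀ * C) i i = ∑ r, C r i ^ 2 := by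
  simp [mul_apply, sq]

lemma trace_mul_le_of_quadForm_le {S W : Matrix (Fin d) (Fin d) ℝ} (hW : W.PosSemidef)
    {v : Fin d → ℝ} {α β : ℝ}
    (h : ∀ x, quadForm S x ≤ α * ∑ i, x i ^ 2 + β * (v ⬝ᵥ x) ^ 2) :
    (S * W).trace ≤ α * W.trace + β * quadForm W v := by
  obtain ⟨C, rfl⟩ := exists_eq_transpose_mul_self hW
  rw [trace_mul_transpose_mul_self, trace_transpose_mul_self, quadForm_transpose_mul_self,
    Finset.mul_sum, Finset.mul_sum, ← Finset.sum_add_distrib]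
  exact Finset.sum_le_sum fun r _ => h _

/-- Off the support of a unit vector `v`, the diagonal of `W` is bounded by the part of the trace
of `W` that `v` does not carry, since `v vᵀ + eⱼ eⱼᵀ` is an orthogonal projection. -/
lemma apply_self_le_trace_sub_quadForm {W : Matrix (Fin d) (Fin d) ℝ} (hW : W.PosSemidef)
    {v : Fin d → ℝ} (hv : l2norm v = 1) {j : Fin d} (hj : v j = 0) :
    W j j ≤ W.trace - quadForm W v := by
  obtain ⟨C, rfl⟩ := exists_eq_transpose_mul_self hW
  rw [trace_transpose_mul_self, quadForm_transpose_mul_self, transpose_mul_self_apply_self,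
    ← Finset.sum_sub_distrib]
  refine Finset.sum_le_sum fun r _ => ?_
  have h1 : v ⬝ᵥ C r = ∑ i ∈ Finset.univ.erase j, v i * C r i := by
    rw [dotProduct, ← Finset.add_sum_erase _ _ (Finset.mem_univ j), hj, zero_mul, zero_add]
  have h2 : ∑ i ∈ Finset.univ.erase j, v i ^ 2 = 1 := by
    have := l2norm_sq v
    rw [hv, ← Finset.add_sum_erase _ _ (Finset.mem_univ j), hj] at this
    linarith
  have h3 := Finset.sum_mul_sq_le_sq_mul_sq (Finset.univ.erase j) v (C r)
  rw [← h1, h2, one_mul] at h3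
  rw [← Finset.add_sum_erase _ (fun i => C r i ^ 2) (Finset.mem_univ j)]
  linarith

/-- On the support of `v`, the diagonal of `W` is close to that of `v vᵀ`; this is the triangle
inequality in the seminorm defined by `W`. -/
lemma abs_mul_sqrt_quadForm_le {W : Matrix (Fin d) (Fin d) ℝ} (hW : W.PosSemidef)
    {v : Fin d → ℝ} (hv : l2norm v = 1) (i : Fin d) :
    |v i| * √(quadForm W v) ≤ √(W i i) + √(W.trace - quadForm W v) := by
  obtain ⟨C, rfl⟩ := exists_eq_transpose_mul_self hW
  have hl : ∀ {m : ℕ} (x : Fin m → ℝ), l2norm x = √(∑ i, x i ^ 2) := fun x => by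
    rw [← l2norm_sq, Real.sqrt_sq (l2norm_nonneg x)]
  have h1 := l2norm_add_le (fun r => C r i) (fun r => v i * (v ⬝ᵥ C r) - C r i)
  have h2 : (fun r => C r i) + (fun r => v i * (v ⬝ᵥ C r) - C r i) =
      v i • fun r => v ⬝ᵥ C r := by
    funext r; simp
  rw [h2, l2norm_smul, hl, hl, hl, ← quadForm_transpose_mul_self,
    ← transpose_mul_self_apply_self] at h1
  refine h1.trans (add_le_add_right (Real.sqrt_le_sqrt ?_) _)
  rw [trace_transpose_mul_self, quadForm_transpose_mul_self, ← Finset.sum_sub_distrib]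
  refine Finset.sum_le_sum fun r _ => ?_
  have h3 : ∑ j, (v j * (v ⬝ᵥ C r) - C r j) ^ 2 = ∑ j, C r j ^ 2 - (v ⬝ᵥ C r) ^ 2 := by
    have e1 : ∑ j, v j ^ 2 = 1 := by rw [← l2norm_sq, hv]; norm_num
    have e2 : ∀ j, (v j * (v ⬝ᵥ C r) - C r j) ^ 2 =
        v j ^ 2 * (v ⬝ᵥ C r) ^ 2 - 2 * (v ⬝ᵥ C r) * (v j * C r j) + C r j ^ 2 := fun j => by ring
    simp_rw [e2]
    rw [Finset.sum_add_distrib, Finset.sum_sub_distrib, ← Finset.sum_mul, ← Finset.mul_sum, e1]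
    change 1 * (v ⬝ᵥ C r) ^ 2 - 2 * (v ⬝ᵥ C r) * (v ⬝ᵥ C r) + _ = _
    ring
  rw [← h3]
  exact Finset.single_le_sum (f := fun j => (v j * (v ⬝ᵥ C r) - C r j) ^ 2)
    (fun _ _ => sq_nonneg _) (Finset.mem_univ i)

/-! ### Sparse vectors and entrywise perturbations -/

lemma IsFeasible.sum_sq {k : ℕ} {x : Fin d → ℝ} (hx : IsFeasible k x) : ∑ i, x i ^ 2 = 1 := by
  rw [← l2norm_sq, hx.1]; norm_num

lemma IsFeasible.sq_sum_abs_le {k : ℕ} {x : Fin d → ℝ} (hx : IsFeasible k x) :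
    (∑ i, |x i|) ^ 2 ≤ k := by
  have hs : ∀ i ∈ Finset.univ, i ∉ supp x → |x i| = 0 := fun i _ hi => by
    simpa [supp] using hi
  rw [← Finset.sum_subset (Finset.subset_univ (supp x)) hs]
  refine sq_sum_le_card_mul_sum_sq.trans ?_
  have h1 : ∑ i ∈ supp x, |x i| ^ 2 ≤ 1 := by
    rw [← hx.sum_sq]
    simp_rw [sq_abs]
    exact Finset.sum_le_univ_sum_of_nonneg fun i => sq_nonneg _
  have h2 : ((supp x).card : ℝ) ≤ k := by exact_mod_cast hx.2
  nlinarith [Nat.cast_nonneg (α := ℝ) (supp x).card]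

lemma IsFeasible.isSDPFeasible_vecMulVec {k : ℕ} {x : Fin d → ℝ} (hx : IsFeasible k x) :
    IsSDPFeasible k (vecMulVec x x) := by
  refine ⟨by simpa using posSemidef_vecMulVec_self_star x, ?_, ?_⟩
  · rw [trace_vecMulVec, dotProduct]
    simp_rw [← sq]; exact hx.sum_sq
  · simp_rw [vecMulVec_apply, abs_mul]
    rw [← Finset.sum_mul_sum, ← sq]
    exact hx.sq_sum_abs_le

lemma trace_mul_vecMulVec_self (A : Matrix (Fin d) (Fin d) ℝ) (x : Fin d → ℝ) :
    (A * vecMulVec x x).trace = quadForm A x := by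
  rw [mul_vecMulVec, trace_vecMulVec, dotProduct_comm, quadForm]

lemma abs_trace_mul_sub_le {A S W : Matrix (Fin d) (Fin d) ℝ} {ε : ℝ}
    (h : ∀ i j, |A i j - S i j| ≤ ε) :
    |(A * W).trace - (S * W).trace| ≤ ε * ∑ i, ∑ j, |W i j| := by
  rw [← trace_sub, ← sub_mul, trace, Finset.sum_comm, Finset.mul_sum]
  simp_rw [diag_apply, mul_apply, Matrix.sub_apply]
  refine (Finset.abs_sum_le_sum_abs _ _).trans (Finset.sum_le_sum fun i _ => ?_)
  rw [Finset.mul_sum]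
  refine (Finset.abs_sum_le_sum_abs _ _).trans (Finset.sum_le_sum fun j _ => ?_)
  rw [abs_mul]
  exact mul_le_mul_of_nonneg_right (h i j) (abs_nonneg _)

lemma IsSDPFeasible.abs_trace_mul_sub_le {A S W : Matrix (Fin d) (Fin d) ℝ} {ε : ℝ} {k : ℕ}
    (hW : IsSDPFeasible k W) (hε : 0 ≤ ε) (h : ∀ i j, |A i j - S i j| ≤ ε) :
    |(A * W).trace - (S * W).trace| ≤ k * ε := by
  refine (SPCA.abs_trace_mul_sub_le h).trans ?_
  rw [mul_comm]
  exact mul_le_mul_of_nonneg_right hW.2.2 hε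

lemma minAbsEntry_le (v : Fin d → ℝ) {i : Fin d} (hi : v i ≠ 0) : minAbsEntry v ≤ |v i| :=
  ciInf_le (f := fun i : {i // v i ≠ 0} => |v i|) (Set.finite_range _).bddBelow ⟨i, hi⟩

lemma IsFeasible.exists_ne_zero {k : ℕ} {x : Fin d → ℝ} (hx : IsFeasible k x) : ∃ i, x i ≠ 0 := by
  by_contra! h
  have := hx.sum_sq
  simp [h] at this

lemma IsFeasible.minAbsEntry_pos {k : ℕ} {x : Fin d → ℝ} (hx : IsFeasible k x) :
    0 < minAbsEntry x := by
  obtain ⟨i, hi⟩ := hx.exists_ne_zero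
  have : Nonempty {i // x i ≠ 0} := ⟨⟨i, hi⟩⟩
  obtain ⟨j, hj⟩ := exists_eq_ciInf_of_finite (f := fun i : {i // x i ≠ 0} => |x i|)
  rw [minAbsEntry, ← hj]
  exact abs_pos.2 j.2

lemma IsFeasible.minAbsEntry_sq_le_one {k : ℕ} {x : Fin d → ℝ} (hx : IsFeasible k x) :
    minAbsEntry x ^ 2 ≤ 1 := by
  obtain ⟨i, hi⟩ := hx.exists_ne_zero
  calc minAbsEntry x ^ 2 ≤ |x i| ^ 2 :=
        pow_le_pow_left₀ hx.minAbsEntry_pos.le (minAbsEntry_le x hi) 2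
    _ = x i ^ 2 := sq_abs _
    _ ≤ ∑ i, x i ^ 2 := Finset.single_le_sum (f := fun i => x i ^ 2)
        (fun _ _ => sq_nonneg _) (Finset.mem_univ i)
    _ = 1 := hx.sum_sq

/-! ### The greedy step under an entrywise perturbation -/

/-- If `W` carries almost its whole trace on `v`, then its `k` largest diagonal entries include
the support of `v`. -/
lemma supp_subset_of_largest_diag {k : ℕ} {W : Matrix (Fin d) (Fin d) ℝ} (hW : W.PosSemidef)
    (htr : W.trace = 1) {v : Fin d → ℝ} (hv : IsFeasible k v)
    (hwv : 1 - quadForm W v ≤ minAbsEntry v ^ 2 / 16)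
    {S₀ : Finset (Fin d)} (hcard : S₀.card = k) (hS₀ : ∀ i ∈ S₀, ∀ j ∉ S₀, W j j ≤ W i i) :
    supp v ⊆ S₀ := by
  intro i hi
  by_contra hiS
  obtain ⟨j, hjS, hjv⟩ : ∃ j ∈ S₀, j ∉ supp v := by
    by_contra! hcon
    have := Finset.eq_of_subset_of_card_le hcon (hcard ▸ hv.2)
    exact hiS (this ▸ hi)
  have hvi : v i ≠ 0 := by simpa [supp] using hi
  have hvj : v j = 0 := by simpa [supp] using hjv
  have ha := hv.minAbsEntry_pos
  have ha1 := hv.minAbsEntry_sq_le_one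
  have h1 := hS₀ j hjS i hiS
  have h2 := apply_self_le_trace_sub_quadForm hW hv.1 hvj
  have h3 := abs_mul_sqrt_quadForm_le hW hv.1 i
  rw [htr] at h2 h3
  have h4 : √(1 - quadForm W v) ≤ minAbsEntry v / 4 := by
    rw [Real.sqrt_le_left (by positivity)]; linarith
  have h5 : √(W i i) ≤ minAbsEntry v / 4 := by
    rw [Real.sqrt_le_left (by positivity)]; linarith
  have h6 : 3 / 4 ≤ √(quadForm W v) := Real.le_sqrt_of_sq_le (by linarith)
  have h7 : minAbsEntry v * (3 / 4) ≤ |v i| * √(quadForm W v) :=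
    mul_le_mul (minAbsEntry_le v hvi) h6 (by norm_num) (abs_nonneg _)
  linarith

/-- The deterministic core: an entrywise perturbation of `N • S` that is small compared with the
spectral gap and with the entries of `v` leaves the greedy vector near-optimal. -/
theorem IsGreedyOutput.isApproxSolution {k : ℕ} {A S W : Matrix (Fin d) (Fin d) ℝ}
    {v : Fin d → ℝ} {lam₁ lam₂ N ε s : ℝ} (hv : IsFeasible k v) (hSv : S *ᵥ v = lam₁ • v)
    (hquad : ∀ x, quadForm S x ≤ lam₂ * ∑ i, x i ^ 2 + (lam₁ - lam₂) * (v ⬝ᵥ x) ^ 2)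
    (hlam₂ : 0 ≤ lam₂) (hgap : 0 < lam₁ - lam₂) (hN : 0 < N) (hε : 0 ≤ ε) (hs : 1 ≤ s)
    (hA : ∀ i j, |A i j - N * S i j| ≤ N * ε)
    (hkε : k * ε ≤ (lam₁ - lam₂) * minAbsEntry v ^ 2 / (32 * s))
    (hW : IsSDPOptimal A k W) {z : Fin d → ℝ} (hz : IsGreedyOutput A W k z) :
    IsApproxSolution A k (1 + 2 / (8 * s - 1)) z := by
  obtain ⟨S₀, hcard, hS₀, hzS, hz1, hzmax⟩ := hz
  have hA' : ∀ i j, |A i j - (N • S) i j| ≤ N * ε := hA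
  have htr : ∀ Y, ((N • S) * Y).trace = N * (S * Y).trace := fun Y => by
    rw [smul_mul, trace_smul, smul_eq_mul]
  have hdev : ∀ Y, IsSDPFeasible k Y → |(A * Y).trace - N * (S * Y).trace| ≤ N * (k * ε) := by
    intro Y hY
    have := hY.abs_trace_mul_sub_le (by positivity) hA'
    rw [htr] at this
    linarith
  have hdevx : ∀ x, IsFeasible k x → |quadForm A x - N * quadForm S x| ≤ N * (k * ε) := by
    intro x hx
    simpa only [trace_mul_vecMulVec_self] using hdev _ hx.isSDPFeasible_vecMulVec
  have hvv : v ⬝ᵥ v = 1 := by rw [dotProduct]; simp_rw [← sq]; exact hv.sum_sq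
  have hSvv : quadForm S v = lam₁ := by
    rw [quadForm, hSv, dotProduct_smul, hvv, smul_eq_mul, mul_one]
  have ha := hv.minAbsEntry_pos
  have ha1 := hv.minAbsEntry_sq_le_one
  have hkε' : 32 * s * (k * ε) ≤ (lam₁ - lam₂) * minAbsEntry v ^ 2 := by
    rw [le_div_iff₀ (by positivity)] at hkε
    linarith
  have hkε0 : 0 ≤ k * ε := by positivity
  have hAv := abs_le.1 (hdevx v hv)
  rw [hSvv] at hAv
  -- optimality of `W` against `v vᵀ` forces `W` to carry almost its whole trace on `v`
  have hwv : 1 - quadForm W v ≤ minAbsEntry v ^ 2 / 16 := by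
    have h1 := hW.2 _ hv.isSDPFeasible_vecMulVec
    rw [trace_mul_vecMulVec_self] at h1
    have h2 := abs_le.1 (hdev W hW.1)
    have h3 := trace_mul_le_of_quadForm_le hW.1.1 hquad
    rw [hW.1.2.1, mul_one] at h3
    have h4 : N * lam₁ - N * (k * ε) ≤ N * (S * W).trace + N * (k * ε) := by linarith
    have h5 : lam₁ - 2 * (k * ε) ≤ (S * W).trace := by
      have : N * (lam₁ - 2 * (k * ε)) ≤ N * (S * W).trace := by linarith
      exact le_of_mul_le_mul_left this hN
    have h6 : (lam₁ - lam₂) * (1 - quadForm W v) ≤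
        (lam₁ - lam₂) * (minAbsEntry v ^ 2 / 16) := by nlinarith
    exact le_of_mul_le_mul_left h6 hgap
  have hsub := supp_subset_of_largest_diag hW.1.1 hW.1.2.1 hv hwv hcard hS₀
  refine ⟨⟨hz1, (Finset.card_le_card hzS).trans hcard.le⟩, fun x hx => ?_⟩
  have hzv := hzmax v hsub hv.1
  have hSx : quadForm S x ≤ lam₁ := by
    have h1 := hquad x
    have h2 := Finset.sum_mul_sq_le_sq_mul_sq Finset.univ v x
    rw [hv.sum_sq, hx.sum_sq, one_mul] at h2
    rw [hx.sum_sq] at h1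
    have h3 : (v ⬝ᵥ x) ^ 2 ≤ 1 := h2
    nlinarith
  have hAx := abs_le.1 (hdevx x hx)
  have hup : quadForm A x ≤ N * (lam₁ + k * ε) := by nlinarith
  have hlow : N * (lam₁ - k * ε) ≤ quadForm A z := by linarith
  have hlam : 8 * s * (k * ε) ≤ lam₁ := by nlinarith
  have hr : 1 + 2 / (8 * s - 1) = (8 * s + 1) / (8 * s - 1) := by
    have : 8 * s - 1 ≠ 0 := by linarith
    field_simp
    ring
  rw [hr, one_div_div, div_mul_eq_mul_div, div_le_iff₀ (by linarith)]
  calc (8 * s - 1) * quadForm A x ≤ (8 * s - 1) * (N * (lam₁ + k * ε)) :=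
        mul_le_mul_of_nonneg_left hup (by linarith)
    _ ≤ N * (lam₁ - k * ε) * (8 * s + 1) := by nlinarith
    _ ≤ quadForm A z * (8 * s + 1) := mul_le_mul_of_nonneg_right hlow (by linarith)

/-! ### The multi-run algorithm -/

lemma IsMultiRunOutput.isApproxSolution {A W : Matrix (Fin d) (Fin d) ℝ} {k N : ℕ} {r : ℝ}
    (h : ∀ z, IsGreedyOutput A W k z → IsApproxSolution A k r z)
    {c : Fin N → Fin d → Bool} {z : Fin d → ℝ} (hz : IsMultiRunOutput A W k N c z) :
    IsApproxSolution A k r z := by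
  obtain ⟨z₀, y, hz₀, -, -, hfeas, hle, -⟩ := hz
  have h₀ := h z₀ hz₀
  exact ⟨hfeas, fun x hx => (h₀.2 x hx).trans (hle h₀.1)⟩

instance isProbabilityMeasure_coinLaw (A W : Matrix (Fin d) (Fin d) ℝ) (k N : ℕ) :
    IsProbabilityMeasure (coinLaw A W k N) := by
  unfold coinLaw; infer_instance

lemma hasApproxRatio_of_forall {A W : Matrix (Fin d) (Fin d) ℝ} {k N : ℕ} {r : ℝ}
    (h : ∀ c z, IsMultiRunOutput A W k N c z → IsApproxSolution A k r z) :
    HasApproxRatio A W k N r := by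
  refine fun z hz => ⟨fun c => (h c _ (hz c)).1, fun x hx => ?_⟩
  calc 1 / r * quadForm A x = ∫ _, 1 / r * quadForm A x ∂(coinLaw A W k N) := by simp
    _ ≤ _ := integral_mono (integrable_const _) Integrable.of_finite
        fun c => (h c _ (hz c)).2 x hx

end SPCA

namespace SPCA

/-! ### Perturbed samples and the sample size -/

variable {n d : ℕ}

lemma l2norm_col_le_maxColNorm (M : Matrix (Fin n) (Fin d) ℝ) (j : Fin d) :
    l2norm (fun i => M i j) ≤ maxColNorm M :=
  le_ciSup (f := fun j => l2norm fun i => M i j) (Set.finite_range _).bddAbove j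

lemma abs_sum_mul_le {m : ℕ} (x y : Fin m → ℝ) : |∑ i, x i * y i| ≤ l2norm x * l2norm y := by
  refine abs_le_of_sq_le_sq ?_ (mul_nonneg (l2norm_nonneg _) (l2norm_nonneg _))
  rw [mul_pow, l2norm_sq, l2norm_sq]
  exact Finset.sum_mul_sq_le_sq_mul_sq _ _ _

lemma abs_gram_add_sub_gram_le (B M : Matrix (Fin n) (Fin d) ℝ) {b β : ℝ}
    (hM : ∀ j, l2norm (fun r => M r j) ≤ b) (hB : ∀ j, l2norm (fun r => B r j) ≤ β)
    (i j : Fin d) : |((B + M)ᵀ * (B + M)) i j - (Bᵀ * B) i j| ≤ 2 * b * β + b ^ 2 := by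
  have e : ((B + M)ᵀ * (B + M)) i j - (Bᵀ * B) i j =
      ∑ r, B r i * M r j + ∑ r, M r i * B r j + ∑ r, M r i * M r j := by
    simp only [mul_apply, transpose_apply, Matrix.add_apply]
    rw [← Finset.sum_sub_distrib, ← Finset.sum_add_distrib, ← Finset.sum_add_distrib]
    exact Finset.sum_congr rfl fun r _ => by ring
  have hb : 0 ≤ b := (l2norm_nonneg _).trans (hM i)
  have hβ : 0 ≤ β := (l2norm_nonneg _).trans (hB i)
  have h1 := (abs_sum_mul_le (fun r => B r i) fun r => M r j).trans
    (mul_le_mul (hB i) (hM j) (l2norm_nonneg _) hβ)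
  have h2 := (abs_sum_mul_le (fun r => M r i) fun r => B r j).trans
    (mul_le_mul (hM i) (hB j) (l2norm_nonneg _) hb)
  have h3 := (abs_sum_mul_le (fun r => M r i) fun r => M r j).trans
    (mul_le_mul (hM i) (hM j) (l2norm_nonneg _) hb)
  rw [e]
  refine (abs_add_three _ _ _).trans ?_
  linarith

/-- The cross terms of `(B + M)ᵀ (B + M)` are controlled by the column norms of `B`, which the
bound on the diagonal of `Bᵀ B` keeps below `17 √(n (σ² + max S i i))`; here `17 ^ 2 = 288 + 1`. -/
lemma abs_perturbed_gram_sub_le (B M : Matrix (Fin n) (Fin d) ℝ) {S : Matrix (Fin d) (Fin d) ℝ}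
    {b σ : ℝ} (hM : maxColNorm M ≤ b) (hS : ∀ i, 0 ≤ S i i)
    (hdn : Real.log d ≤ n)
    (hB : ∀ i j, |(Bᵀ * B) i j - n * S i j| ≤ 288 * σ ^ 2 * √(n * Real.log d)) (i j : Fin d) :
    |((B + M)ᵀ * (B + M)) i j - n * S i j| ≤
      288 * σ ^ 2 * √(n * Real.log d) + 34 * b * √(n * (σ ^ 2 + ⨆ i, S i i)) + b ^ 2 := by
  have hn : (0 : ℝ) ≤ n := n.cast_nonneg
  have hcol : ∀ j, l2norm (fun r => B r j) ≤ 17 * √(n * (σ ^ 2 + ⨆ i, S i i)) := by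
    intro j
    have h1 := (abs_le.1 (hB j j)).2
    have h2 : S j j ≤ ⨆ i, S i i := le_ciSup (f := fun i => S i i) (Set.finite_range _).bddAbove j
    have h0 := hS j
    have h3 : √(n * Real.log d) ≤ n := by
      rw [Real.sqrt_le_left hn, sq]
      exact mul_le_mul_of_nonneg_left hdn hn
    have h4 : l2norm (fun r => B r j) ^ 2 = (Bᵀ * B) j j := by
      rw [l2norm_sq]; simp [mul_apply, sq]
    refine le_of_sq_le_sq ?_ (by positivity)
    rw [h4, mul_pow, Real.sq_sqrt (mul_nonneg hn (by nlinarith [sq_nonneg σ]))]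
    have h5 : σ ^ 2 * √(n * Real.log d) ≤ σ ^ 2 * n := mul_le_mul_of_nonneg_left h3 (sq_nonneg σ)
    have h6 : n * S j j ≤ n * ⨆ i, S i i := mul_le_mul_of_nonneg_left h2 hn
    have h7 : 0 ≤ n * ⨆ i, S i i := mul_nonneg hn (h0.trans h2)
    have h8 : 0 ≤ σ ^ 2 * n := by positivity
    linarith
  have h1 := abs_gram_add_sub_gram_le B M (fun j => (l2norm_col_le_maxColNorm M j).trans hM)
    hcol i j
  have h2 := hB i j
  have h3 := abs_sub_le (((B + M)ᵀ * (B + M)) i j) ((Bᵀ * B) i j) (n * S i j)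
  linarith

lemma mul_sqrt_le_of_sampleSize {k x D g s N : ℝ} (hD : 0 ≤ D) (hg : 0 < g) (hN : 0 ≤ N)
    (h : 400000000 * s ^ 2 * (k ^ 2 * x ^ 2 * D / g ^ 2) ≤ N) :
    20000 * s * (k * (x * √(N * D))) ≤ N * g := by
  refine le_of_sq_le_sq ?_ (by positivity)
  rw [← mul_div_assoc, div_le_iff₀ (by positivity)] at h
  have := mul_le_mul_of_nonneg_left h hN
  have e : (20000 * s * (k * (x * √(N * D)))) ^ 2 =
      400000000 * s ^ 2 * (k ^ 2 * x ^ 2 * √(N * D) ^ 2) := by ring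
  rw [e, Real.sq_sqrt (by positivity)]
  linarith

/-- A sample of size `l` times the sample bound makes the entrywise error small compared with the
spectral gap times the squared smallest nonzero entry of `v`. The constant `4 * 10 ^ 8` is the
square of `20000`, which exceeds `32 * (288 + 34 + 1)`. -/
lemma entry_error_le_of_sampleBound_le {k : ℕ} {σ b gap l : ℝ} {S : Matrix (Fin d) (Fin d) ℝ}
    {v : Fin d → ℝ} (hd : 1 ≤ d) (hgap : 0 < gap) (ha : 0 < minAbsEntry v)
    (hS : 0 ≤ ⨆ i, S i i) (hl : 1 ≤ l) (h : l * sampleBound 400000000 k σ b gap S v ≤ n) :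
    32 * √l * (k * (288 * σ ^ 2 * √(n * Real.log d) + 34 * b * √(n * (σ ^ 2 + ⨆ i, S i i)) +
      b ^ 2)) ≤ n * (gap * minAbsEntry v ^ 2) := by
  set g := gap * minAbsEntry v ^ 2 with hgdef
  set K := σ ^ 2 + ⨆ i, S i i
  have hg : 0 < g := by positivity
  have hK : 0 ≤ K := by positivity
  have hlog : 0 ≤ Real.log d := Real.log_nonneg (by exact_mod_cast hd)
  have hn : (0 : ℝ) ≤ n := n.cast_nonneg
  have hl0 : 0 ≤ l := by linarith
  have hs1 : 1 ≤ √l := Real.one_le_sqrt.2 hl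
  have hs2 : √l ^ 2 = l := Real.sq_sqrt hl0
  have h1 := (mul_le_mul_of_nonneg_left (le_max_left _ _) hl0).trans h
  -- the three summands of the bound are nonnegative, so `n` dominates each of them separately
  have eg : gap ^ 2 * minAbsEntry v ^ 4 = g ^ 2 := by rw [hgdef]; ring
  rw [eg, add_div, ← hs2] at h1
  have p1 : 0 ≤ (k : ℝ) ^ 2 * σ ^ 4 * Real.log d / g ^ 2 := by positivity
  have p2 : 0 ≤ b ^ 2 * (k : ℝ) ^ 2 * K / g ^ 2 := by positivity
  have p3 : 0 ≤ (k : ℝ) * b ^ 2 / g := by positivity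
  have ps : 0 ≤ √l ^ 2 := sq_nonneg _
  have q1 := mul_sqrt_le_of_sampleSize (k := k) (x := σ ^ 2) (D := Real.log d) (g := g) (s := √l)
    (N := n) hlog hg hn (by
      rw [← pow_mul]
      nlinarith [mul_nonneg ps p2, mul_nonneg ps p3])
  have q2 := mul_sqrt_le_of_sampleSize (k := k) (x := b) (D := K) (g := g) (s := √l)
    (N := n) hK hg hn (by
      rw [mul_comm ((k : ℝ) ^ 2)]
      nlinarith [mul_nonneg ps p1, mul_nonneg ps p3])
  have q3 : 400000000 * √l * (k * b ^ 2) ≤ n * g := by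
    have h2 : 400000000 * √l ^ 2 * (k * b ^ 2 / g) ≤ n := by
      nlinarith [mul_nonneg ps p1, mul_nonneg ps p2]
    rw [← mul_div_assoc, div_le_iff₀ hg] at h2
    have h3 : √l ≤ √l ^ 2 := by nlinarith
    have h4 : √l * (k * b ^ 2) ≤ √l ^ 2 * (k * b ^ 2) :=
      mul_le_mul_of_nonneg_right h3 (by positivity)
    linarith
  have hng : 0 ≤ n * g := by positivity
  linarith

end SPCA

/-! ### The approximation guarantee -/

theorem mainTheorem5 :
    ∃ C : ℝ, 0 < C ∧
      ∀ (n d k : ℕ) (hd : 2 ≤ d) (_ : k ≤ d)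
        (Ω : Type*) [MeasurableSpace Ω] (μ : Measure Ω) [IsProbabilityMeasure μ]
        (B : Ω → Matrix (Fin n) (Fin d) ℝ) (σ : ℝ≥0)
        (S : Matrix (Fin d) (Fin d) ℝ) (hS : S.IsHermitian)
        (_ : SPCA.IsSubGaussianSample μ B σ S)
        (lam₁ lam₂ : ℝ)
        (_ : lam₁ = SPCA.sortedEigenvalue hS ⟨0, by omega⟩)
        (_ : lam₂ = SPCA.sortedEigenvalue hS ⟨1, by omega⟩)
        (_ : 0 < lam₁ - lam₂)
        (v : Fin d → ℝ) (_ : SPCA.IsFeasible k v) (_ : S *ᵥ v = lam₁ • v)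
        (b : ℝ) (_ : 0 < b)
        -- the perturbation may depend on the data in an arbitrary way
        (M : Ω → Matrix (Fin n) (Fin d) ℝ) (_ : ∀ ω, SPCA.maxColNorm (M ω) ≤ b)
        (A : Ω → Matrix (Fin d) (Fin d) ℝ) (_ : ∀ ω, A ω = (B ω + M ω)ᵀ * (B ω + M ω))
        (W : Ω → Matrix (Fin d) (Fin d) ℝ) (_ : ∀ ω, SPCA.IsSDPOptimal (A ω) k (W ω))
        (l : ℝ) (_ : 1 ≤ l)
        (_ : l * SPCA.sampleBound C k σ b (lam₁ - lam₂) S v ≤ n),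
      ∃ G : Set Ω, MeasurableSet G ∧ 1 - (d : ℝ) ^ (-10 : ℤ) ≤ μ.real G ∧
        ∀ ω ∈ G,
          -- the greedy vector alone
          (∀ z, SPCA.IsGreedyOutput (A ω) (W ω) k z →
            SPCA.IsApproxSolution (A ω) k (1 + 2 / (8 * √l - 1)) z) ∧
          -- the full algorithm, in expectation over its coins and for every outcome of them
          ∀ N : ℕ,
            SPCA.HasApproxRatio (A ω) (W ω) k N (1 + 2 / (8 * √l - 1)) ∧
            ∀ c z, SPCA.IsMultiRunOutput (A ω) (W ω) k N c z →
              SPCA.IsApproxSolution (A ω) k (1 + 2 / (8 * √l - 1)) z := by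
  refine ⟨400000000, by norm_num, ?_⟩
  intro n d k hd _ Ω _ μ _ B σ S hS hB lam₁ lam₂ hlam₁ hlam₂ hgap v hv hSv b hb M hM A hA W hW
    l hl hn
  subst hlam₁ hlam₂
  have ha := hv.minAbsEntry_pos
  -- the terms `4 / a ^ 2` and `log d` of the sample bound give `0 < n` and `log d ≤ n`
  have hmax := (mul_le_mul_of_nonneg_left (le_max_right _ _) (by linarith : (0 : ℝ) ≤ l)).trans hn
  have hpos : 0 < 4 / SPCA.minAbsEntry v ^ 2 := by positivity
  have hnpos : 0 < n := by
    have h1 : 0 < l * max (4 / SPCA.minAbsEntry v ^ 2) (Real.log d) :=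
      mul_pos (by linarith) (lt_max_of_lt_left hpos)
    exact_mod_cast h1.trans_le hmax
  have hnpos' : (0 : ℝ) < n := by exact_mod_cast hnpos
  have hdn : Real.log d ≤ n := by
    have h1 := le_max_right (4 / SPCA.minAbsEntry v ^ 2) (Real.log d)
    have h2 := lt_max_of_lt_left (b := 4 / SPCA.minAbsEntry v ^ 2) (c := Real.log d) hpos
    nlinarith
  have hquad := SPCA.quadForm_le_of_gap hS hd hv.1 hSv (by linarith)
  have hlam₂ := SPCA.sortedEigenvalue_nonneg hS (hB.quadForm_nonneg ⟨0, hnpos⟩) ⟨1, by omega⟩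
  have hσ : 0 < σ := by
    refine hB.sigma_pos ⟨0, hnpos⟩ hv.1 ?_
    have hvv : v ⬝ᵥ v = 1 := by rw [dotProduct]; simp_rw [← sq]; exact hv.sum_sq
    rw [SPCA.quadForm, hSv, dotProduct_smul, hvv, smul_eq_mul, mul_one]
    linarith
  have hSii : ∀ i, 0 ≤ S i i := fun i => by
    simpa [SPCA.quadForm] using hB.quadForm_nonneg ⟨0, hnpos⟩ (Pi.single i 1)
  have herr := SPCA.entry_error_le_of_sampleBound_le (by omega) hgap ha
    (Real.iSup_nonneg hSii) hl hn
  set η := 288 * (σ : ℝ) ^ 2 * √(n * Real.log d) + 34 * b * √(n * (σ ^ 2 + ⨆ i, S i i)) + b ^ 2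
    with hη
  have hη0 : 0 ≤ η := by positivity
  have hs : 1 ≤ √l := Real.one_le_sqrt.2 hl
  obtain ⟨G, hG, hGprob, hGood⟩ := hB.exists_good_event hσ hd hnpos hdn
  refine ⟨G, hG, hGprob, fun ω hω => ?_⟩
  have hgreedy : ∀ z, SPCA.IsGreedyOutput (A ω) (W ω) k z →
      SPCA.IsApproxSolution (A ω) k (1 + 2 / (8 * √l - 1)) z := fun z hz =>
    hz.isApproxSolution (N := n) (ε := η / n) hv hSv hquad hlam₂ hgap hnpos' (by positivity) hs
      (fun i j => by
        rw [hA ω, mul_div_cancel₀ _ hnpos'.ne']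
        exact SPCA.abs_perturbed_gram_sub_le (B ω) (M ω) (hM ω) hSii hdn (hGood ω hω) i j)
      (by
        rw [← mul_div_assoc, div_le_div_iff₀ hnpos' (by positivity)]
        linarith)
      (hW ω)
  have hrun : ∀ N c z, SPCA.IsMultiRunOutput (A ω) (W ω) k N c z →
      SPCA.IsApproxSolution (A ω) k (1 + 2 / (8 * √l - 1)) z := fun N c z hz =>
    hz.isApproxSolution hgreedy
  exact ⟨hgreedy, fun N => ⟨SPCA.hasApproxRatio_of_forall (hrun N), hrun N⟩⟩
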